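/- **Setting.** A point-normal pair is $P=(p,n)$ with $p\in\mathbb R^2$ and $n\in\mathbb R^2$ a unit vector. For unit vectors $u,v$ let $\theta(u,v)\in[0,\pi]$ be the angle between them. If $\theta(u,v)<\pi$ and $\omega\in\mathbb R$, let $GA(u,v;\omega)$ be the unit vector with angle $(1-\omega)\alpha+\omega\beta$, where $u=(\cos\alpha,\sin\alpha)$, $v=(\cos\beta,\sin\beta)$ and $|\beta-\alpha|<\pi$. **Circle average.** Let $P_0=(p_0,n_0)$ and $P_1=(p_1,n_1)$ with $\theta=\theta(n_0,n_1)<\pi$ (for $\theta=\pi$ the average is undefined), and $\omega\in\mathbb R$. Then $P_0\circledcirc_\omega P_1=(p_\omega,n_\omega)$, where $n_\omega=GA(n_0,n_1;\omega)$ and $p_\omega$ is as follows. If $n_0=n_1$, then $p_\omega=(1-\omega)p_0+\omega p_1$; if $p_0=p_1$, then $p_\omega=p_0$. Otherwise consider the two circles through $p_0,p_1$ on which the chord $p_0p_1$ has central angle $\theta$, and their short arcs between $p_0$ and $p_1$, one on each side of the line $p_0p_1$. Let $q$ be the intersection point of the lines $p_0+\mathbb R n_0$ and $p_1+\mathbb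 R n_1$. If $n_0$ and $n_1$ point to different sides of the line $p_0p_1$, select the arc on the side of $q$; otherwise select the arc on the other side. (If one of the normals is parallel to $p_0p_1$, both are considered to point to the same side, and $q$ is considered to lie on the side of the other normal if the parallel normal points towards the other point, and on the opposite side if it points away from it.) Then $p_\omega$ is the image of $p_0$ under the rotation about the centre of the selected circle by $\omega$ times the oriented angle that leads along the selected arc from $p_0$ to $p_1$ (so for $\omega<0$ or $\omega>1$ the arc is extended). **Scheme.** The modified 4-point scheme (M4Pt) maps data $P^0=(P^0_i)_{i\in\mathbb Z}$ to $P^j=(P^j_i)_{i\in\mathbb Z}$, $P^j_i=(p^j_i,n^j_i)$, by $P^{j+1}_{2i}=P^j_i$ and $$P^{j+1}_{2i+1}=S_L\circledcirc_{1/2}S_R,\qquad S_L=P^j_i\circledcirc_{-1/8}P^j_{i-1},\quad S_R=P^j_{i+1}\circledcirc_{-1/8}P^j_{i+2}.$$ **Theorem (The M4Pt scheme is convergent).** Let $P^0$ be any initial data for which all the circle averages of the first refinement step are defined, i.e. neither $n^0_i,n^0_{i+1}$ nor the normals of $S_L,S_R$ are ever opposite. Then: 1. All the circle averages of all refinement steps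 are defined. 2. There are continuous limits $c:\mathbb R\to\mathbb R^2$ and $\nu:\mathbb R\to S^1$ such that, as $j\to\infty$, the control polygons of level $j$ (piecewise linear, with value $p^j_i$ at $2^{-j}i$) converge to $c$ uniformly on compact sets, and uniformly on $\mathbb R$ if the initial edge lengths $|p^0_i-p^0_{i+1}|$ are bounded; and the piecewise geodesic interpolants of the normals (with value $n^j_i$ at $2^{-j}i$) converge to $\nu$ uniformly on $\mathbb R$. 3. With $e^j=\sup_{i}|p^j_i-p^j_{i+1}|\in[0,\infty]$, for every $\eta>\tfrac34$ there is $J$ such that $e^{j+1}\le\eta\,e^j$ for all $j\ge J$. -/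

import Mathlib

open Filter Topology
open scoped ENNReal ComplexConjugate

noncomputable section

/-- A point-normal pair in the Euclidean plane, which is identified with `ℂ`: a point together
with a unit vector. -/
structure PointNormal where
  pt : ℂ
  nrm : Circle

namespace PointNormal

/-- The (unsigned) angle `θ(u, v) ∈ [0, π]` between two unit vectors. -/
def theta (u v : Circle) : ℝ := InnerProductGeometry.angle (u : ℂ) (v : ℂ)

/-- The weighted geodesic average of two unit vectors with angles `α`, `β`: the unit vector with
angle `(1 - ω) α + ω β`, the angles being chosen such that `β - α = arg (v / u)` lies in
`(-π, π]`. Any real weight is allowed. -/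
def geodesicAvg (u v : Circle) (ω : ℝ) : Circle :=
  u * Circle.exp (ω * Complex.arg ((v / u : Circle) : ℂ))

/-- The cross product of two plane vectors. -/
def cross (u v : ℂ) : ℝ := (conj u * v).im

/-- The side of the directed line `a → b` to which the vector `v` points:
`1` is the left-hand side, `-1` is the right-hand side and `0` means that `v` is parallel to it. -/
def side (a b v : ℂ) : SignType := SignType.sign (cross (b - a) v)

/-- The line through the point of `P` in the direction of its normal. -/
def normalLine (P : PointNormal) : Set ℂ := {z | ∃ s : ℝ, z = P.pt + s * (P.nrm : ℂ)}

/-- The intersection point `q` of the two normal lines, if the normals are not parallel. -/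
def normalsMeet (P₀ P₁ : PointNormal) : ℂ :=
  P₀.pt + ((cross (P₁.pt - P₀.pt) P₁.nrm / cross P₀.nrm P₁.nrm : ℝ) : ℂ) * (P₀.nrm : ℂ)

theorem normalsMeet_mem (P₀ P₁ : PointNormal) (h : cross P₀.nrm P₁.nrm ≠ 0) :
    normalsMeet P₀ P₁ ∈ normalLine P₀ ∧ normalsMeet P₀ P₁ ∈ normalLine P₁ := by
  refine ⟨⟨_, rfl⟩, cross (P₁.pt - P₀.pt) P₀.nrm / cross P₀.nrm P₁.nrm, ?_⟩
  unfold normalsMeet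
  have h1 := inv_mul_cancel₀ h
  simp only [div_eq_mul_inv]
  generalize (cross P₀.nrm P₁.nrm)⁻¹ = k at h1 ⊢
  simp only [cross, Complex.mul_im, Complex.conj_re, Complex.conj_im] at h1
  apply Complex.ext
  · simp only [cross, Complex.mul_im, Complex.conj_re, Complex.conj_im,
      Complex.add_re, Complex.re_ofReal_mul, Complex.sub_re, Complex.sub_im]
    linear_combination (P₁.pt.re - P₀.pt.re) * h1
  · simp only [cross, Complex.mul_im, Complex.conj_re, Complex.conj_im,
      Complex.add_im, Complex.ofReal_re, Complex.ofReal_im, Complex.sub_re, Complex.sub_im]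
    linear_combination (P₁.pt.im - P₀.pt.im) * h1

/-- The side of `p₀ → p₁` on which the intersection point `q` of the normal lines is considered
to lie. If one of the normals, say `nᵢ`, is parallel to `p₀p₁`, then `q` is taken to be on the side
of the other normal when `nᵢ` points from `pᵢ` towards the other point (for `i = 1` this is
`θ(n₁, p₁ - p₀) = π`), and on the opposite side when it points away from the other point (for
`i = 1` this is `θ(n₁, p₁ - p₀) = 0`). -/
def meetSide (P₀ P₁ : PointNormal) : SignType :=
  if side P₀.pt P₁.pt P₁.nrm = 0 then
    if InnerProductGeometry.angle (P₁.nrm : ℂ) (P₁.pt - P₀.pt) = Real.pi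
      then side P₀.pt P₁.pt P₀.nrm else -side P₀.pt P₁.pt P₀.nrm
  else if side P₀.pt P₁.pt P₀.nrm = 0 then
    if InnerProductGeometry.angle (P₀.nrm : ℂ) (P₀.pt - P₁.pt) = Real.pi
      then side P₀.pt P₁.pt P₁.nrm else -side P₀.pt P₁.pt P₁.nrm
  else side P₀.pt P₁.pt (normalsMeet P₀ P₁ - P₀.pt)

/-- Selection criterion: the side of `p₀ → p₁` on which the selected candidate arc lies. It is the
side of `q` if the normals point to different sides, and the other side otherwise; a normal
parallel to `p₀p₁` is considered to point to the same side as the other normal. -/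
def arcSide (P₀ P₁ : PointNormal) : SignType :=
  if side P₀.pt P₁.pt P₀.nrm ≠ 0 ∧ side P₀.pt P₁.pt P₁.nrm ≠ 0 ∧
      side P₀.pt P₁.pt P₀.nrm ≠ side P₀.pt P₁.pt P₁.nrm
  then meetSide P₀ P₁ else -meetSide P₀ P₁

/-- The oriented central angle under which the selected arc leads from `p₀` to `p₁`. Its absolute
value is `θ = θ(n₀, n₁)`. The short arc on the left of `p₀ → p₁` is traversed clockwise. -/
def centralAngle (P₀ P₁ : PointNormal) : ℝ :=
  if arcSide P₀ P₁ = 1 then -theta P₀.nrm P₁.nrm else theta P₀.nrm P₁.nrm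

/-- The centre of the candidate circle on which the rotation by `φ` about the centre takes `a`
to `b`. The values `φ = ± θ` give the two candidate circles. -/
def candidateCenter (a b : ℂ) (φ : ℝ) : ℂ :=
  a + (b - a) / (1 - Complex.exp (φ * Complex.I))

theorem candidateCenter_spec (a b : ℂ) (φ : ℝ) (h : Complex.exp (φ * Complex.I) ≠ 1) :
    b - candidateCenter a b φ
      = Complex.exp (φ * Complex.I) * (a - candidateCenter a b φ) := by
  have h' : 1 - Complex.exp (φ * Complex.I) ≠ 0 := sub_ne_zero.mpr (Ne.symm h)
  unfold candidateCenter
  field_simp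
  ring

open Classical in
/-- The point of the circle average: the point of the selected circle that is obtained from `p₀`
by rotating about the centre through `ω` times the central angle of the selected arc (for a weight
`ω < 0` or `ω > 1` this extends the arc outward), with the two special cases `n₀ = n₁` and
`p₀ = p₁`. -/
def avgPoint (P₀ P₁ : PointNormal) (ω : ℝ) : ℂ :=
  if P₀.nrm = P₁.nrm then (1 - ω) * P₀.pt + ω * P₁.pt
  else if P₀.pt = P₁.pt then P₀.pt
  else
    candidateCenter P₀.pt P₁.pt (centralAngle P₀ P₁) +
      Complex.exp ((ω * centralAngle P₀ P₁ : ℝ) * Complex.I) *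
        (P₀.pt - candidateCenter P₀.pt P₁.pt (centralAngle P₀ P₁))

/-- The construction of the circle average is not defined for opposite normals. -/
def AvgDefined (P₀ P₁ : PointNormal) : Prop := theta P₀.nrm P₁.nrm ≠ Real.pi

/-- The circle average `P₀ ⊚_ω P₁`; a meaningless value if `AvgDefined P₀ P₁` fails. -/
def circleAvg (P₀ P₁ : PointNormal) (ω : ℝ) : PointNormal where
  pt := avgPoint P₀ P₁ ω
  nrm := geodesicAvg P₀.nrm P₁.nrm ω

/-- `S_L = P_i ⊚_{-1/8} P_{i-1}`. -/
def leftPair (P : ℤ → PointNormal) (i : ℤ) : PointNormal := circleAvg (P i) (P (i - 1)) (-1 / 8)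

/-- `S_R = P_{i+1} ⊚_{-1/8} P_{i+2}`. -/
def rightPair (P : ℤ → PointNormal) (i : ℤ) : PointNormal :=
  circleAvg (P (i + 1)) (P (i + 2)) (-1 / 8)

/-- One refinement step of the modified 4-point scheme: the pair with index `2i` is `P_i` and the
pair with index `2i + 1` is `S_L ⊚_{1/2} S_R`. -/
def m4ptStep (P : ℤ → PointNormal) (k : ℤ) : PointNormal :=
  if Even k then P (k / 2) else circleAvg (leftPair P (k / 2)) (rightPair P (k / 2)) (1 / 2)

/-- The data `P^j` generated by the modified 4-point scheme at level `j`. -/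
def m4pt (P : ℤ → PointNormal) : ℕ → ℤ → PointNormal
  | 0 => P
  | j + 1 => m4ptStep (m4pt P j)

/-- All the circle averages in one refinement step of the scheme are defined. -/
def StepDefined (P : ℤ → PointNormal) : Prop :=
  ∀ i : ℤ, AvgDefined (P i) (P (i - 1)) ∧ AvgDefined (P (i + 1)) (P (i + 2)) ∧
    AvgDefined (leftPair P i) (rightPair P i)

/-- The supremum `e` of the lengths of the edges of the control polygon. -/
def maxEdge (P : ℤ → PointNormal) : ℝ≥0∞ := ⨆ i : ℤ, edist (P i).pt (P (i + 1)).pt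

/-- The control polygon of level `j`: the piecewise linear curve with value `p_i` at the parameter
`2^{-j} i`. -/
def pointCurve (j : ℕ) (P : ℤ → PointNormal) (t : ℝ) : ℂ :=
  AffineMap.lineMap (P ⌊2 ^ j * t⌋).pt (P (⌊2 ^ j * t⌋ + 1)).pt (Int.fract (2 ^ j * t))

/-- The piecewise geodesic curve on the unit circle with value `n_i` at the parameter
`2^{-j} i`. -/
def normalCurve (j : ℕ) (P : ℤ → PointNormal) (t : ℝ) : Circle :=
  geodesicAvg (P ⌊2 ^ j * t⌋).nrm (P (⌊2 ^ j * t⌋ + 1)).nrm (Int.fract (2 ^ j * t))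

end PointNormal

end

/-!
The point of a circle average with weight `ω` is `p₀ + z (p₁ - p₀)` with the complex weight
`z = (1 - exp (i ω φ)) / (1 - exp (i φ))`, where `φ = ± θ` and the sign depends on the selected arc
(and `z = ω` if `φ = 0`).
For either sign `‖z - ω‖ ≤ 2 θ` when `|ω| ≤ 1 / 2` (`exists_avgPoint_eq`), so the scheme is a
perturbation of the linear 4-point scheme by terms of the order of the angles between neighbouring
normals, and the geometric selection rule plays no role in the convergence.

The normals evolve independently of the points. The triangle inequality for angles shows that the
largest angle between neighbours shrinks by the factor `1/8 + 1/2 * (5/4) = 3/4` in each step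
(`theta_m4ptStep_le`), also in the first one, where the normals of `S_L` and `S_R` may enclose a
smaller angle than the one that leads through the normals `n_i` and `n_{i+1}`. From level `1` on the
angle between the normals of `S_L` and `S_R` is thus at most `5/4 * 3/4 * π < π`, and all averages
are defined.

As the angles tend to `0`, the contraction factor of the edge lengths tends to the factor `5/8` of
the linear scheme (`maxEdge_m4ptStep_le`), which is less than `3/4`. Hence the largest edge lengths
are summable when the initial ones are bounded. Both convergence claims then follow from one fact
about interpolatory dyadic refinement with summable neighbour distances
(`exists_tendstoUniformly_of_dyadic`). For unbounded initial edges, the scheme is local, so that on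
a bounded set the initial points may be replaced by a sequence that is eventually constant on both
sides, without a change of the normals (`pointCurve_truncatePoints`).
-/

namespace PointNormal

/-! ### Angles and geodesic averages of unit vectors -/

lemma theta_eq_abs_arg (u v : Circle) : theta u v = |Complex.arg ((v / u : Circle) : ℂ)| := by
  rw [theta, InnerProductGeometry.angle_comm,
    Complex.angle_eq_abs_arg (Circle.coe_ne_zero v) (Circle.coe_ne_zero u), Circle.coe_div]

lemma theta_nonneg (u v : Circle) : 0 ≤ theta u v := InnerProductGeometry.angle_nonneg _ _

lemma theta_le_pi (u v : Circle) : theta u v ≤ Real.pi := InnerProductGeometry.angle_le_pi _ _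

lemma theta_comm (u v : Circle) : theta u v = theta v u := InnerProductGeometry.angle_comm _ _

lemma theta_triangle (u v w : Circle) : theta u w ≤ theta u v + theta v w :=
  InnerProductGeometry.angle_le_angle_add_angle _ _ _

lemma dist_le_theta (u v : Circle) : dist u v ≤ theta u v := by
  have h := Complex.norm_sub_le_angle (Circle.norm_coe u) (Circle.norm_coe v)
  rwa [← dist_eq_norm] at h

lemma theta_mul_exp_le (u : Circle) (x : ℝ) : theta u (u * Circle.exp x) ≤ |x| := by
  rcases le_or_gt Real.pi |x| with h | h
  · exact (theta_le_pi _ _).trans h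
  · rw [theta_eq_abs_arg, mul_div_cancel_left, Circle.arg_exp (abs_lt.1 h).1 (abs_lt.1 h).2.le]

lemma theta_geodesicAvg_left (u v : Circle) (ω : ℝ) :
    theta u (geodesicAvg u v ω) ≤ |ω| * theta u v := by
  rw [theta_eq_abs_arg u v, ← abs_mul]
  exact theta_mul_exp_le _ _

lemma geodesicAvg_zero (u v : Circle) : geodesicAvg u v 0 = u := by
  simp [geodesicAvg]

lemma geodesicAvg_one (u v : Circle) : geodesicAvg u v 1 = v := by
  rw [geodesicAvg, one_mul, Circle.exp_arg, mul_div_cancel]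

lemma continuous_geodesicAvg (u v : Circle) : Continuous (geodesicAvg u v) := by
  unfold geodesicAvg
  fun_prop

lemma theta_geodesicAvg_right (u v : Circle) (ω : ℝ) :
    theta (geodesicAvg u v ω) v ≤ |1 - ω| * theta u v := by
  have h : v = geodesicAvg u v ω *
      Circle.exp ((1 - ω) * Complex.arg ((v / u : Circle) : ℂ)) := by
    rw [geodesicAvg, mul_assoc, ← Circle.exp_add, ← add_mul, add_sub_cancel]
    exact (geodesicAvg_one u v).symm
  rw [theta_eq_abs_arg u v, ← abs_mul]
  conv_lhs => rw [h]
  convert theta_mul_exp_le _ _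

/-! ### The point of a circle average as a perturbed affine average -/

/-- Chords of the unit circle subtending the angles `ω φ` and `φ` have, as complex numbers, the
ratio `ω + O(φ)`. -/
lemma norm_chord_ratio_sub_le {φ ω : ℝ} (h0 : φ ≠ 0) (hφ : |φ| ≤ Real.pi) (hω : |ω| ≤ 1 / 2) :
    ‖(1 - Complex.exp ((ω * φ : ℝ) * Complex.I)) / (1 - Complex.exp (φ * Complex.I)) - ω‖
      ≤ 2 * |φ| := by
  have hpos : 0 < |φ| := abs_pos.2 h0
  have hpi := Real.pi_pos
  have hden : 2 / Real.pi * |φ| ≤ ‖1 - Complex.exp (φ * Complex.I)‖ := by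
    have hs : Real.sin (|φ| / 2) ≤ |Real.sin (φ / 2)| := by
      rcases abs_cases φ with ⟨h, -⟩ | ⟨h, -⟩
      · rw [h]; exact le_abs_self _
      · rw [h, neg_div, Real.sin_neg]; exact neg_le_abs _
    rw [norm_sub_rev, mul_comm (φ : ℂ), Complex.norm_exp_I_mul_ofReal_sub_one,
      Real.norm_eq_abs, abs_mul, abs_two]
    linarith [Real.mul_le_sin (x := |φ| / 2) (by positivity) (by linarith)]
  have hden0 : 1 - Complex.exp (φ * Complex.I) ≠ 0 :=
    norm_pos_iff.1 (lt_of_lt_of_le (by positivity) hden)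
  have hquad : ∀ x : ℝ, |x| ≤ 1 → ‖Complex.exp (x * Complex.I) - 1 - x * Complex.I‖ ≤ x ^ 2 := by
    intro x hx
    have h := Complex.norm_exp_sub_one_sub_id_le (x := x * Complex.I) (by simpa using hx)
    simpa using h
  have hlin : ∀ x : ℝ, ‖Complex.exp (x * Complex.I) - 1‖ ≤ |x| := by
    intro x
    rw [mul_comm]
    exact Real.norm_exp_I_mul_ofReal_sub_one_le
  have hω2 : |ω * φ| ≤ 1 / 2 * |φ| := by
    rw [abs_mul]; gcongr
  have hnum : ‖(1 - Complex.exp ((ω * φ : ℝ) * Complex.I)) -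
      ω * (1 - Complex.exp (φ * Complex.I))‖ ≤ |φ| ^ 2 := by
    -- The quadratic Taylor estimate needs `|φ| ≤ 1`; beyond that, linear bounds suffice.
    rcases le_or_gt |φ| 1 with h | h
    · have e : (1 - Complex.exp ((ω * φ : ℝ) * Complex.I)) -
          ω * (1 - Complex.exp (φ * Complex.I)) =
          ω * (Complex.exp (φ * Complex.I) - 1 - φ * Complex.I) -
          (Complex.exp ((ω * φ : ℝ) * Complex.I) - 1 - (ω * φ : ℝ) * Complex.I) := by
        push_cast; ring
      rw [e]
      refine (norm_sub_le _ _).trans ?_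
      rw [norm_mul, Complex.norm_real, Real.norm_eq_abs]
      have h1 := hquad φ h
      have h2 := hquad (ω * φ) (by linarith)
      have h3 : |ω| * ‖Complex.exp (φ * Complex.I) - 1 - φ * Complex.I‖ ≤ 1 / 2 * φ ^ 2 := by
        gcongr
      have h4 : (ω * φ) ^ 2 ≤ (1 / 2 * |φ|) ^ 2 := by
        rw [← sq_abs (ω * φ)]; gcongr
      rw [mul_pow (1 / 2), sq_abs] at h4
      rw [sq_abs]
      linarith [sq_nonneg φ]
    · have h1 := hlin φ
      have h2 := hlin (ω * φ)
      rw [norm_sub_rev] at h1 h2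
      refine (norm_sub_le _ _).trans ?_
      rw [norm_mul, Complex.norm_real, Real.norm_eq_abs]
      have h3 : |ω| * ‖1 - Complex.exp (φ * Complex.I)‖ ≤ 1 / 2 * |φ| := by gcongr
      nlinarith
  rw [div_sub' hden0, norm_div, div_le_iff₀ (norm_pos_iff.2 hden0), mul_comm _ (ω : ℂ)]
  refine hnum.trans ?_
  have h1 : (1 : ℝ) ≤ 2 * (2 / Real.pi) := by
    rw [← mul_div_assoc, le_div_iff₀ hpi]; linarith [Real.pi_le_four]
  calc |φ| ^ 2 = 1 * |φ| ^ 2 := (one_mul _).symm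
    _ ≤ 2 * (2 / Real.pi) * |φ| ^ 2 := by gcongr
    _ = 2 * |φ| * (2 / Real.pi * |φ|) := by ring
    _ ≤ _ := by gcongr

lemma abs_centralAngle (P₀ P₁ : PointNormal) : |centralAngle P₀ P₁| = theta P₀.nrm P₁.nrm := by
  unfold centralAngle
  split_ifs
  · rw [abs_neg, abs_of_nonneg (theta_nonneg _ _)]
  · rw [abs_of_nonneg (theta_nonneg _ _)]

/-- The point of a circle average is an affine combination of the two points with a complex weight
that differs from `ω` by at most a multiple of the angle between the normals, whichever arc is
selected. -/
lemma exists_avgPoint_eq (P₀ P₁ : PointNormal) {ω : ℝ} (hω : |ω| ≤ 1 / 2) :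
    ∃ z : ℂ, ‖z - ω‖ ≤ 2 * theta P₀.nrm P₁.nrm ∧
      avgPoint P₀ P₁ ω = P₀.pt + z * (P₁.pt - P₀.pt) := by
  have hθ := theta_nonneg P₀.nrm P₁.nrm
  by_cases hn : P₀.nrm = P₁.nrm
  · refine ⟨ω, by simpa using hθ, ?_⟩
    rw [avgPoint, if_pos hn]; ring
  by_cases hp : P₀.pt = P₁.pt
  · refine ⟨ω, by simpa using hθ, ?_⟩
    rw [avgPoint, if_neg hn, if_pos hp, hp]; ring
  have hφ : centralAngle P₀ P₁ ≠ 0 := by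
    rw [← abs_pos, abs_centralAngle]
    exact (dist_pos.2 hn).trans_le (dist_le_theta _ _)
  have hle : |centralAngle P₀ P₁| ≤ Real.pi := (abs_centralAngle P₀ P₁).trans_le (theta_le_pi _ _)
  refine ⟨_, (norm_chord_ratio_sub_le hφ hle hω).trans_eq (by rw [abs_centralAngle]), ?_⟩
  rw [avgPoint, if_neg hn, if_neg hp, candidateCenter]
  simp only [div_eq_mul_inv]
  ring

/-! ### One refinement step -/

lemma m4ptStep_two_mul (P : ℤ → PointNormal) (i : ℤ) : m4ptStep P (2 * i) = P i := by
  simp [m4ptStep]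

lemma m4ptStep_two_mul_add_one (P : ℤ → PointNormal) (i : ℤ) :
    m4ptStep P (2 * i + 1) = circleAvg (leftPair P i) (rightPair P i) (1 / 2) := by
  have h : (2 * i + 1) / 2 = i := by omega
  rw [m4ptStep, if_neg (by simp [parity_simps]), h]

section Angles

variable {P : ℤ → PointNormal} {Θ : ℝ}

lemma theta_leftPair_le (hΘ : ∀ i, theta (P i).nrm (P (i + 1)).nrm ≤ Θ) (i : ℤ) :
    theta (P i).nrm (leftPair P i).nrm ≤ 1 / 8 * Θ := by
  refine (theta_geodesicAvg_left _ _ _).trans ?_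
  have h := hΘ (i - 1)
  rw [sub_add_cancel, theta_comm] at h
  rw [show |(-1 / 8 : ℝ)| = 1 / 8 by norm_num [abs_of_neg]]
  gcongr

lemma theta_rightPair_le (hΘ : ∀ i, theta (P i).nrm (P (i + 1)).nrm ≤ Θ) (i : ℤ) :
    theta (rightPair P i).nrm (P (i + 1)).nrm ≤ 1 / 8 * Θ := by
  rw [theta_comm]
  refine (theta_geodesicAvg_left _ _ _).trans ?_
  have h := hΘ (i + 1)
  rw [add_assoc, one_add_one_eq_two] at h
  rw [show |(-1 / 8 : ℝ)| = 1 / 8 by norm_num [abs_of_neg]]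
  gcongr

lemma theta_leftPair_rightPair_le (hΘ : ∀ i, theta (P i).nrm (P (i + 1)).nrm ≤ Θ) (i : ℤ) :
    theta (leftPair P i).nrm (rightPair P i).nrm ≤ 5 / 4 * Θ := by
  have h1 := theta_leftPair_le hΘ i
  have h2 := theta_rightPair_le hΘ i
  have h3 := theta_triangle (leftPair P i).nrm (P i).nrm (rightPair P i).nrm
  have h4 := theta_triangle (P i).nrm (P (i + 1)).nrm (rightPair P i).nrm
  rw [theta_comm] at h1 h2
  linarith [hΘ i]

/-- The triangle inequality for angles gives the factor `1/8 + 1/2 * (5/4) = 3/4`. -/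
lemma theta_m4ptStep_le (hΘ : ∀ i, theta (P i).nrm (P (i + 1)).nrm ≤ Θ) (k : ℤ) :
    theta (m4ptStep P k).nrm (m4ptStep P (k + 1)).nrm ≤ 3 / 4 * Θ := by
  obtain ⟨i, rfl | rfl⟩ := Int.even_or_odd' k
  · rw [m4ptStep_two_mul, m4ptStep_two_mul_add_one]
    have h1 := theta_geodesicAvg_left (leftPair P i).nrm (rightPair P i).nrm (1 / 2)
    have h2 := theta_triangle (P i).nrm (leftPair P i).nrm
      (geodesicAvg (leftPair P i).nrm (rightPair P i).nrm (1 / 2))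
    rw [show |(1 / 2 : ℝ)| = 1 / 2 by norm_num] at h1
    change theta _ (geodesicAvg _ _ _) ≤ _
    linarith [theta_leftPair_le hΘ i, theta_leftPair_rightPair_le hΘ i]
  · rw [add_assoc, show 2 * i + (1 + 1) = 2 * (i + 1) by ring, m4ptStep_two_mul,
      m4ptStep_two_mul_add_one]
    have h1 := theta_geodesicAvg_right (leftPair P i).nrm (rightPair P i).nrm (1 / 2)
    have h2 := theta_triangle (geodesicAvg (leftPair P i).nrm (rightPair P i).nrm (1 / 2))
      (rightPair P i).nrm (P (i + 1)).nrm
    rw [show |1 - (1 / 2 : ℝ)| = 1 / 2 by norm_num] at h1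
    change theta (geodesicAvg _ _ _) _ ≤ _
    linarith [theta_rightPair_le hΘ i, theta_leftPair_rightPair_le hΘ i]

end Angles

/-- The contraction factor for the edge lengths in a refinement step in which adjacent normals
enclose angles of at most `Θ`. At `Θ = 0` it is the factor `5/8` of the linear 4-point scheme; the
terms `5/2 * Θ` bound the deviation of the weights of all three circle averages, whose normals
enclose angles of at most `5/4 * Θ`. -/
noncomputable def edgeFactor (Θ : ℝ) : ℝ := (1 / 2 + 5 / 2 * Θ) * (1 + 2 * (1 / 8 + 5 / 2 * Θ))

/-- The edge from `P_i` to the inserted point is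
`z d_i + (1 - z) z₁ (p_{i-1} - p_i) + z z₂ d_{i+1}`, where `z`, `z₁`, `z₂` are the perturbed weights
of the three circle averages and `d_i = p_{i+1} - p_i`, and the edge from the inserted point to `P_{i+1}` is analogous. -/
lemma dist_m4ptStep_le {P : ℤ → PointNormal} {Θ e : ℝ}
    (hΘ : ∀ i, theta (P i).nrm (P (i + 1)).nrm ≤ Θ)
    (he : ∀ i, dist (P i).pt (P (i + 1)).pt ≤ e) (k : ℤ) :
    dist (m4ptStep P k).pt (m4ptStep P (k + 1)).pt ≤ edgeFactor Θ * e := by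
  have hΘ0 : 0 ≤ Θ := (theta_nonneg _ _).trans (hΘ 0)
  have he0 : 0 ≤ e := dist_nonneg.trans (he 0)
  have key : ∀ i, ∃ A : ℂ, (circleAvg (leftPair P i) (rightPair P i) (1 / 2)).pt = A ∧
      dist (P i).pt A ≤ edgeFactor Θ * e ∧ dist A (P (i + 1)).pt ≤ edgeFactor Θ * e := by
    intro i
    refine ⟨_, rfl, ?_⟩
    obtain ⟨z₁, hz₁, e₁⟩ := exists_avgPoint_eq (P i) (P (i - 1)) (ω := -1 / 8)
      (by norm_num [abs_of_neg])
    obtain ⟨z₂, hz₂, e₂⟩ := exists_avgPoint_eq (P (i + 1)) (P (i + 2)) (ω := -1 / 8)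
      (by norm_num [abs_of_neg])
    obtain ⟨z, hz, e₃⟩ := exists_avgPoint_eq (leftPair P i) (rightPair P i) (ω := 1 / 2)
      (by norm_num)
    have t₁ := hΘ (i - 1)
    have t₂ := hΘ (i + 1)
    have d₁ := he (i - 1)
    have d₀ := he i
    have d₂ := he (i + 1)
    rw [sub_add_cancel] at t₁ d₁
    rw [add_assoc, one_add_one_eq_two] at t₂ d₂
    rw [theta_comm] at t₁
    rw [dist_comm, dist_eq_norm] at d₁ d₀ d₂
    have t₃ := theta_leftPair_rightPair_le hΘ i
    have n₁ : ‖z₁‖ ≤ 1 / 8 + 5 / 2 * Θ := by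
      have := norm_le_norm_add_norm_sub' z₁ ((-1 / 8 : ℝ) : ℂ)
      rw [Complex.norm_real, Real.norm_eq_abs,
        show |(-1 / 8 : ℝ)| = 1 / 8 by norm_num [abs_of_neg]] at this
      linarith
    have n₂ : ‖z₂‖ ≤ 1 / 8 + 5 / 2 * Θ := by
      have := norm_le_norm_add_norm_sub' z₂ ((-1 / 8 : ℝ) : ℂ)
      rw [Complex.norm_real, Real.norm_eq_abs,
        show |(-1 / 8 : ℝ)| = 1 / 8 by norm_num [abs_of_neg]] at this
      linarith
    have n₃ : ‖z‖ ≤ 1 / 2 + 5 / 2 * Θ := by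
      have := norm_le_norm_add_norm_sub' z ((1 / 2 : ℝ) : ℂ)
      rw [Complex.norm_real, Real.norm_eq_abs, show |(1 / 2 : ℝ)| = 1 / 2 by norm_num] at this
      linarith
    have n₄ : ‖1 - z‖ ≤ 1 / 2 + 5 / 2 * Θ := by
      have := norm_le_norm_add_norm_sub' (1 - z) ((1 / 2 : ℝ) : ℂ)
      rw [Complex.norm_real, Real.norm_eq_abs, show |(1 / 2 : ℝ)| = 1 / 2 by norm_num,
        show 1 - z - ((1 / 2 : ℝ) : ℂ) = ((1 / 2 : ℝ) : ℂ) - z by push_cast; ring,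
        norm_sub_rev ((1 / 2 : ℝ) : ℂ) z] at this
      linarith
    -- Both new edges are combinations of the old edges `d₀`, `d₁`, `d₂`: the middle one has a
    -- coefficient near `1 / 2`, the outer ones have coefficients near `± 1 / 2 * (1 / 8)`.
    have bound : ∀ a v b w c x₀ x₁ x₂ : ℂ, ‖a‖ ≤ 1 / 2 + 5 / 2 * Θ → ‖v‖ ≤ 1 / 2 + 5 / 2 * Θ →
        ‖w‖ ≤ 1 / 2 + 5 / 2 * Θ → ‖b‖ ≤ 1 / 8 + 5 / 2 * Θ → ‖c‖ ≤ 1 / 8 + 5 / 2 * Θ →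
        ‖x₀‖ ≤ e → ‖x₁‖ ≤ e → ‖x₂‖ ≤ e →
        ‖a * x₀ + v * b * x₁ + w * c * x₂‖ ≤ edgeFactor Θ * e := by
      intro a v b w c x₀ x₁ x₂ ha hv hw hb hc h₀ h₁ h₂
      refine norm_add₃_le.trans ?_
      simp only [norm_mul]
      calc _ ≤ (1 / 2 + 5 / 2 * Θ) * e + (1 / 2 + 5 / 2 * Θ) * (1 / 8 + 5 / 2 * Θ) * e +
            (1 / 2 + 5 / 2 * Θ) * (1 / 8 + 5 / 2 * Θ) * e := by gcongr
        _ = _ := by rw [edgeFactor]; ring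
    have e₁' : (leftPair P i).pt = (P i).pt + z₁ * ((P (i - 1)).pt - (P i).pt) := e₁
    have e₂' : (rightPair P i).pt =
      (P (i + 1)).pt + z₂ * ((P (i + 2)).pt - (P (i + 1)).pt) := e₂
    constructor
    · rw [dist_comm, dist_eq_norm]
      refine le_of_eq_of_le (congrArg _ ?_)
        (bound z (-(1 - z)) z₁ z z₂ _ _ _ n₃ (by rwa [norm_neg]) n₃ n₁ n₂ d₀ d₁ d₂)
      change avgPoint _ _ _ - _ = _
      rw [e₃, e₁', e₂']
      ring
    · rw [dist_comm, dist_eq_norm]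
      refine le_of_eq_of_le (congrArg _ ?_)
        (bound (1 - z) (1 - z) z₁ (-z) z₂ _ _ _ n₄ n₄ (by rwa [norm_neg]) n₁ n₂ d₀ d₁ d₂)
      change _ - avgPoint _ _ _ = _
      rw [e₃, e₁', e₂']
      ring
  obtain ⟨i, rfl | rfl⟩ := Int.even_or_odd' k
  · rw [m4ptStep_two_mul, m4ptStep_two_mul_add_one]
    obtain ⟨A, rfl, h, -⟩ := key i
    exact h
  · rw [add_assoc, show 2 * i + (1 + 1) = 2 * (i + 1) by ring, m4ptStep_two_mul,
      m4ptStep_two_mul_add_one]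
    obtain ⟨A, rfl, -, h⟩ := key i
    exact h

lemma dist_le_toReal_maxEdge {P : ℤ → PointNormal} (h : maxEdge P ≠ ⊤) (i : ℤ) :
    dist (P i).pt (P (i + 1)).pt ≤ (maxEdge P).toReal := by
  rw [dist_edist]
  exact ENNReal.toReal_mono h (le_iSup (fun i : ℤ => edist (P i).pt (P (i + 1)).pt) i)

lemma maxEdge_m4ptStep_le {P : ℤ → PointNormal} {Θ : ℝ}
    (hΘ : ∀ i, theta (P i).nrm (P (i + 1)).nrm ≤ Θ) :
    maxEdge (m4ptStep P) ≤ ENNReal.ofReal (edgeFactor Θ) * maxEdge P := by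
  have hΘ0 : 0 ≤ Θ := (theta_nonneg _ _).trans (hΘ 0)
  have hpos : 0 < edgeFactor Θ := by unfold edgeFactor; positivity
  by_cases h : maxEdge P = ⊤
  · rw [h, ENNReal.mul_top (by simpa using hpos)]
    exact le_top
  · refine iSup_le fun k => ?_
    rw [edist_dist, ← ENNReal.ofReal_toReal h, ← ENNReal.ofReal_mul hpos.le]
    exact ENNReal.ofReal_le_ofReal
      (dist_m4ptStep_le hΘ (dist_le_toReal_maxEdge h) k)

/-! ### All refinement steps -/

lemma theta_m4pt_le (P : ℤ → PointNormal) (j : ℕ) (i : ℤ) :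
    theta (m4pt P j i).nrm (m4pt P j (i + 1)).nrm ≤ Real.pi * (3 / 4) ^ j := by
  induction j generalizing i with
  | zero => simpa using theta_le_pi _ _
  | succ j ih =>
    refine (theta_m4ptStep_le ih i).trans_eq ?_
    ring

/-- Angles below `4π/5` between adjacent normals exclude opposite normals in the next step. -/
lemma stepDefined_of_theta_le {P : ℤ → PointNormal} {Θ : ℝ}
    (hΘ : ∀ i, theta (P i).nrm (P (i + 1)).nrm ≤ Θ) (h : 5 / 4 * Θ < Real.pi) :
    StepDefined P := by
  have hpi := Real.pi_pos
  have hlt : Θ < Real.pi := by linarith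
  intro i
  refine ⟨?_, ?_, ((theta_leftPair_rightPair_le hΘ i).trans_lt h).ne⟩
  · have h1 := hΘ (i - 1)
    rw [sub_add_cancel, theta_comm] at h1
    exact (h1.trans_lt hlt).ne
  · have h1 := hΘ (i + 1)
    rw [add_assoc, one_add_one_eq_two] at h1
    exact (h1.trans_lt hlt).ne

lemma stepDefined_m4pt {P : ℤ → PointNormal} (hP : StepDefined P) (j : ℕ) :
    StepDefined (m4pt P j) := by
  cases j with
  | zero => exact hP
  | succ j =>
    refine stepDefined_of_theta_le (theta_m4pt_le P (j + 1)) ?_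
    have h : (3 / 4 : ℝ) ^ (j + 1) ≤ 3 / 4 := by
      simpa using pow_le_pow_of_le_one (by norm_num) (by norm_num) (Nat.le_add_left 1 j)
        (a := (3 / 4 : ℝ))
    nlinarith [Real.pi_pos]

lemma maxEdge_m4pt_succ_le_of_lt (P : ℤ → PointNormal) {η : ℝ} (hη : 5 / 8 < η) :
    ∃ J : ℕ, ∀ j : ℕ, J ≤ j →
      maxEdge (m4pt P (j + 1)) ≤ ENNReal.ofReal η * maxEdge (m4pt P j) := by
  have h1 : Tendsto (fun j : ℕ => Real.pi * (3 / 4 : ℝ) ^ j) atTop (𝓝 0) := by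
    simpa using (tendsto_pow_atTop_nhds_zero_of_lt_one (r := (3 / 4 : ℝ)) (by norm_num)
      (by norm_num)).const_mul Real.pi
  have h2 : Continuous edgeFactor := by unfold edgeFactor; fun_prop
  have h3 := (h2.tendsto 0).comp h1
  have h4 : edgeFactor 0 = 5 / 8 := by norm_num [edgeFactor]
  rw [h4] at h3
  obtain ⟨J, hJ⟩ := eventually_atTop.1 (h3.eventually_le_const hη)
  refine ⟨J, fun j hj => (maxEdge_m4ptStep_le (theta_m4pt_le P j)).trans ?_⟩
  gcongr
  exact hJ j hj

lemma maxEdge_m4pt_ne_top {P : ℤ → PointNormal} (h : maxEdge P ≠ ⊤) (j : ℕ) :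
    maxEdge (m4pt P j) ≠ ⊤ := by
  induction j with
  | zero => exact h
  | succ j ih =>
    exact ne_top_of_le_ne_top (ENNReal.mul_ne_top ENNReal.ofReal_ne_top ih)
      (maxEdge_m4ptStep_le (theta_m4pt_le P j))

lemma summable_maxEdge_m4pt {P : ℤ → PointNormal} (h : maxEdge P ≠ ⊤) :
    Summable fun j => (maxEdge (m4pt P j)).toReal := by
  obtain ⟨J, hJ⟩ := maxEdge_m4pt_succ_le_of_lt P (η := 3 / 4) (by norm_num)
  refine summable_of_ratio_norm_eventually_le (r := 3 / 4) (by norm_num)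
    (eventually_atTop.2 ⟨J, fun j hj => ?_⟩)
  rw [Real.norm_of_nonneg ENNReal.toReal_nonneg, Real.norm_of_nonneg ENNReal.toReal_nonneg,
    ← ENNReal.toReal_ofReal (r := 3 / 4) (by norm_num), ← ENNReal.toReal_mul]
  exact ENNReal.toReal_mono
    (ENNReal.mul_ne_top ENNReal.ofReal_ne_top (maxEdge_m4pt_ne_top h j)) (hJ j hj)

/-! ### Convergence of curves interpolating dyadic data -/

lemma continuous_of_eqOn_Icc_int {X : Type*} [TopologicalSpace X] {f : ℝ → X} (g : ℤ → ℝ → X)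
    (hg : ∀ i, Continuous (g i)) (hfg : ∀ i : ℤ, Set.EqOn f (g i) (Set.Icc i (i + 1))) :
    Continuous f := by
  have hfin : LocallyFinite fun i : ℤ => Set.Icc (i : ℝ) (i + 1) :=
    locallyFinite_Icc_of_tendsto tendsto_intCast_atTop_atTop
      (tendsto_atBot_add_const_right _ _ (tendsto_intCast_atBot_iff.2 tendsto_id))
  refine hfin.continuous ?_ (fun _ => isClosed_Icc) fun i => (hg i).continuousOn.congr (hfg i)
  exact Set.eq_univ_of_forall fun x => Set.mem_iUnion.2
    ⟨⌊x⌋, Int.floor_le x, (Int.lt_floor_add_one x).le⟩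

/-- A curve that on `[i, i + 1)` is `g i` at the fractional part of the parameter is continuous
if the pieces match. -/
lemma continuous_floor_fract {X : Type*} [TopologicalSpace X] (g : ℤ → ℝ → X)
    (hg : ∀ i, Continuous (g i)) (hmatch : ∀ i, g i 1 = g (i + 1) 0) :
    Continuous fun x : ℝ => g ⌊x⌋ (Int.fract x) := by
  refine continuous_of_eqOn_Icc_int (fun i x => g i (x - i)) (fun i => by have := hg i; fun_prop)
    fun i x hx => ?_
  rcases hx.2.lt_or_eq with h | rfl
  · have hi : ⌊x⌋ = i := Int.floor_eq_iff.2 ⟨hx.1, h⟩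
    simp only [Int.fract, hi]
  · have hi : ⌊(i : ℝ) + 1⌋ = i + 1 := by simp
    simp only [Int.fract, hi]
    push_cast
    rw [sub_self, add_sub_cancel_left, hmatch]

lemma floor_two_pow_succ_mul (j : ℕ) (t : ℝ) :
    ⌊(2 : ℝ) ^ (j + 1) * t⌋ = 2 * ⌊(2 : ℝ) ^ j * t⌋ ∨
      ⌊(2 : ℝ) ^ (j + 1) * t⌋ = 2 * ⌊(2 : ℝ) ^ j * t⌋ + 1 := by
  have h1 := Int.floor_le ((2 : ℝ) ^ j * t)
  have h2 := Int.lt_floor_add_one ((2 : ℝ) ^ j * t)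
  have h3 : 2 * ⌊(2 : ℝ) ^ j * t⌋ ≤ ⌊(2 : ℝ) ^ (j + 1) * t⌋ :=
    Int.le_floor.2 (by push_cast; rw [pow_succ]; linarith)
  have h4 : ⌊(2 : ℝ) ^ (j + 1) * t⌋ < 2 * ⌊(2 : ℝ) ^ j * t⌋ + 2 :=
    Int.floor_lt.2 (by push_cast; rw [pow_succ]; linarith)
  omega

/-- Curves `F j` that stay close to data `x j` on the grids `2^{-j} ℤ` converge uniformly if each
data set interpolates the preceding one and the distances of neighbours are summable. -/
lemma exists_tendstoUniformly_of_dyadic {X : Type*} [MetricSpace X] [CompleteSpace X]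
    (x : ℕ → ℤ → X) {D : ℕ → ℝ} (hD : Summable D) (hx : ∀ j i, dist (x j i) (x j (i + 1)) ≤ D j)
    (hsub : ∀ j i, x (j + 1) (2 * i) = x j i) (F : ℕ → ℝ → X)
    (hF : ∀ j t, dist (x j ⌊(2 : ℝ) ^ j * t⌋) (F j t) ≤ D j) (hc : ∀ j, Continuous (F j)) :
    ∃ f : ℝ → X, Continuous f ∧ TendstoUniformly F f atTop := by
  have hstep : ∀ t j, dist (F j t) (F (j + 1) t) ≤ D j + 2 * D (j + 1) := by
    intro t j
    have h1 := hF j t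
    have h2 := hF (j + 1) t
    have h3 : dist (x j ⌊(2 : ℝ) ^ j * t⌋) (x (j + 1) ⌊(2 : ℝ) ^ (j + 1) * t⌋) ≤ D (j + 1) := by
      rw [← hsub]
      rcases floor_two_pow_succ_mul j t with h | h
      · rw [h, dist_self]
        exact dist_nonneg.trans h2
      · rw [h]
        exact hx _ _
    rw [dist_comm] at h1
    have h4 := dist_triangle4 (F j t) (x j ⌊(2 : ℝ) ^ j * t⌋)
      (x (j + 1) ⌊(2 : ℝ) ^ (j + 1) * t⌋) (F (j + 1) t)
    linarith
  have hsum : Summable fun j => D j + 2 * D (j + 1) :=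
    hD.add (((summable_nat_add_iff 1).2 hD).mul_left 2)
  choose f hf using fun t =>
    cauchySeq_tendsto_of_complete (cauchySeq_of_dist_le_of_summable _ (hstep t) hsum)
  have hunif : TendstoUniformly F f atTop := by
    rw [Metric.tendstoUniformly_iff]
    intro ε hε
    filter_upwards [(tendsto_sum_nat_add fun j => D j + 2 * D (j + 1)).eventually_lt_const hε]
      with j hj t
    rw [dist_comm]
    refine (dist_le_tsum_of_dist_le_of_tendsto _ (hstep t) hsum (hf t) j).trans_lt ?_
    simpa only [add_comm j] using hj
  exact ⟨f, hunif.continuous (Frequently.of_forall hc), hunif⟩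

/-! ### Normals -/

lemma continuous_normalCurve (j : ℕ) (P : ℤ → PointNormal) : Continuous (normalCurve j P) := by
  have h := continuous_floor_fract (fun i => geodesicAvg (P i).nrm (P (i + 1)).nrm)
    (fun i => continuous_geodesicAvg _ _) (fun i => by rw [geodesicAvg_one, geodesicAvg_zero])
  exact h.comp (continuous_const.mul continuous_id)

lemma exists_tendstoUniformly_normalCurve (P : ℤ → PointNormal) :
    ∃ ν : ℝ → Circle, Continuous ν ∧
      TendstoUniformly (fun (j : ℕ) (t : ℝ) => normalCurve j (m4pt P j) t) ν atTop := by
  refine exists_tendstoUniformly_of_dyadic (fun j i => (m4pt P j i).nrm)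
    ((summable_geometric_of_lt_one (r := (3 / 4 : ℝ)) (by norm_num) (by norm_num)).mul_left
      Real.pi)
    (fun j i => (dist_le_theta _ _).trans (theta_m4pt_le P j i))
    (fun j i => by rw [m4pt, m4ptStep_two_mul]) _ (fun j t => ?_)
    (fun j => continuous_normalCurve j _)
  refine (dist_le_theta _ _).trans ((theta_geodesicAvg_left _ _ _).trans ?_)
  rw [Int.abs_fract]
  exact (mul_le_of_le_one_left (theta_nonneg _ _) (Int.fract_lt_one _).le).trans
    (theta_m4pt_le P j _)

/-! ### Points -/

lemma continuous_pointCurve (j : ℕ) (P : ℤ → PointNormal) : Continuous (pointCurve j P) := by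
  have h := continuous_floor_fract
    (fun i => (AffineMap.lineMap (P i).pt (P (i + 1)).pt : ℝ →ᵃ[ℝ] ℂ))
    (fun i => AffineMap.lineMap_continuous) (fun i => by simp)
  exact h.comp (continuous_const.mul continuous_id)

lemma exists_tendstoUniformly_pointCurve {P : ℤ → PointNormal} (h : maxEdge P ≠ ⊤) :
    ∃ c : ℝ → ℂ, Continuous c ∧
      TendstoUniformly (fun (j : ℕ) (t : ℝ) => pointCurve j (m4pt P j) t) c atTop := by
  have hd : ∀ j i, dist (m4pt P j i).pt (m4pt P j (i + 1)).pt ≤ (maxEdge (m4pt P j)).toReal :=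
    fun j i => dist_le_toReal_maxEdge (maxEdge_m4pt_ne_top h j) i
  refine exists_tendstoUniformly_of_dyadic (fun j i => (m4pt P j i).pt)
    (summable_maxEdge_m4pt h) hd (fun j i => by rw [m4pt, m4ptStep_two_mul]) _ (fun j t => ?_)
    (fun j => continuous_pointCurve j _)
  rw [pointCurve, dist_left_lineMap, Real.norm_eq_abs, Int.abs_fract]
  exact (mul_le_of_le_one_left dist_nonneg (Int.fract_lt_one _).le).trans (hd j _)

/-- The scheme is local: the data of level `j` on `[-N, N]` depend only on the initial data with
indices in `[-(N + 3), N + 3]`. -/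
lemma m4pt_eq_of_eqOn {P Q : ℤ → PointNormal} {N : ℕ} (h : ∀ k : ℤ, |k| ≤ N + 3 → P k = Q k)
    (j : ℕ) (k : ℤ) (hk : |k| ≤ 2 ^ j * N + 3) : m4pt P j k = m4pt Q j k := by
  induction j generalizing k with
  | zero => exact h k (by simpa using hk)
  | succ j ih =>
    rw [pow_succ] at hk
    generalize hm : (2 : ℤ) ^ j * N = m at ih
    have hm0 : 0 ≤ m := hm ▸ by positivity
    have hk' : |k| ≤ 2 * m + 3 := by rw [← hm]; linarith
    rw [abs_le] at hk'
    have h0 := ih (k / 2) (abs_le.2 (by omega))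
    simp only [m4pt, m4ptStep]
    split_ifs with hev
    · exact h0
    · rw [Int.not_even_iff_odd] at hev
      obtain ⟨i, rfl⟩ := hev
      simp only [leftPair, rightPair]
      rw [h0, ih _ (abs_le.2 (by omega)), ih _ (abs_le.2 (by omega)), ih _ (abs_le.2 (by omega))]

/-- The data whose points are constant on each side of the indices `[-K, K]`, with the same normals.
Keeping the normals preserves all angles, and the edge lengths become bounded. -/
def truncatePoints (P : ℤ → PointNormal) (K : ℕ) (i : ℤ) : PointNormal where
  pt := (P (max (-K) (min K i))).pt
  nrm := (P i).nrm

lemma truncatePoints_eq (P : ℤ → PointNormal) {K : ℕ} {i : ℤ} (hi : |i| ≤ K) :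
    truncatePoints P K i = P i := by
  rw [abs_le] at hi
  rw [truncatePoints, min_eq_right hi.2, max_eq_right hi.1]

lemma maxEdge_truncatePoints_ne_top (P : ℤ → PointNormal) (K : ℕ) :
    maxEdge (truncatePoints P K) ≠ ⊤ := by
  refine ne_top_of_le_ne_top (b := ∑ k ∈ Finset.Icc (-K : ℤ) K, edist (P k).pt (P (k + 1)).pt)
    (ENNReal.sum_ne_top.2 fun k _ => edist_ne_top _ _) (iSup_le fun i => ?_)
  simp only [truncatePoints]
  by_cases hi : -(K : ℤ) ≤ i ∧ i < K
  · rw [min_eq_right hi.2.le, max_eq_right hi.1, min_eq_right (by omega), max_eq_right (by omega)]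
    exact Finset.single_le_sum (f := fun k : ℤ => edist (P k).pt (P (k + 1)).pt)
      (fun _ _ => zero_le) (Finset.mem_Icc.2 ⟨hi.1, hi.2.le⟩)
  · have h : max (-(K : ℤ)) (min K i) = max (-(K : ℤ)) (min K (i + 1)) := by omega
    rw [h, edist_self]
    exact zero_le

lemma pointCurve_truncatePoints (P : ℤ → PointNormal) (N j : ℕ) {t : ℝ} (ht : |t| ≤ N) :
    pointCurve j (m4pt (truncatePoints P (N + 3)) j) t = pointCurve j (m4pt P j) t := by
  rw [abs_le] at ht
  have h2 : (0 : ℝ) < 2 ^ j := by positivity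
  have hlo : -(2 ^ j * N : ℤ) ≤ ⌊(2 : ℝ) ^ j * t⌋ := Int.le_floor.2 (by push_cast; nlinarith)
  have hhi : ⌊(2 : ℝ) ^ j * t⌋ ≤ (2 ^ j * N : ℤ) := by
    have h : (⌊(2 : ℝ) ^ j * t⌋ : ℝ) ≤ ((2 ^ j * N : ℤ) : ℝ) :=
      (Int.floor_le _).trans (by push_cast; nlinarith)
    exact_mod_cast h
  have hagree : ∀ k : ℤ, |k| ≤ N + 3 → truncatePoints P (N + 3) k = P k := fun k hk =>
    truncatePoints_eq P (by exact_mod_cast hk)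
  rw [pointCurve, pointCurve, m4pt_eq_of_eqOn hagree j _ (abs_le.2 ⟨by linarith, by linarith⟩),
    m4pt_eq_of_eqOn hagree j _ (abs_le.2 ⟨by linarith, by linarith⟩)]

lemma exists_tendstoLocallyUniformly_pointCurve (P : ℤ → PointNormal) :
    ∃ c : ℝ → ℂ, Continuous c ∧ TendstoLocallyUniformly
      (fun (j : ℕ) (t : ℝ) => pointCurve j (m4pt P j) t) c atTop := by
  -- Limits of the truncated data, glued together: the `N`-th one is correct on `[-N, N]`.
  choose c _ hu using fun N : ℕ =>
    exists_tendstoUniformly_pointCurve (maxEdge_truncatePoints_ne_top P (N + 3))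
  have hpt : ∀ (N : ℕ) (t : ℝ), |t| ≤ N →
      Tendsto (fun j => pointCurve j (m4pt P j) t) atTop (𝓝 (c N t)) := fun N t ht =>
    ((hu N).tendsto_at t).congr fun j => pointCurve_truncatePoints P N j ht
  have heq : ∀ (N : ℕ) (t : ℝ), |t| ≤ N → c ⌈|t|⌉₊ t = c N t := fun N t ht =>
    tendsto_nhds_unique (hpt _ t (Nat.le_ceil _)) (hpt N t ht)
  have hloc : TendstoLocallyUniformly
      (fun (j : ℕ) (t : ℝ) => pointCurve j (m4pt P j) t) (fun t => c ⌈|t|⌉₊ t) atTop := by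
    intro u hmem t
    obtain ⟨N, hN⟩ := exists_nat_gt |t|
    refine ⟨{s | |s| < N}, (isOpen_lt continuous_abs continuous_const).mem_nhds hN, ?_⟩
    filter_upwards [hu N u hmem] with j hj s hs
    have hs' : |s| ≤ N := le_of_lt hs
    rw [heq N s hs', ← pointCurve_truncatePoints P N j hs']
    exact hj s
  exact ⟨_, hloc.continuous (Frequently.of_forall fun j => continuous_pointCurve j _), hloc⟩

end PointNormal

theorem mainTheorem4 (P : ℤ → PointNormal) (hP : PointNormal.StepDefined P) :
    -- every circle average that the scheme forms, at every level, is defined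
    (∀ j : ℕ, PointNormal.StepDefined (PointNormal.m4pt P j)) ∧
    -- the points and the normals converge to continuous limits
    (∃ (c : ℝ → ℂ) (ν : ℝ → Circle), Continuous c ∧ Continuous ν ∧
      TendstoLocallyUniformly
        (fun (j : ℕ) (t : ℝ) => PointNormal.pointCurve j (PointNormal.m4pt P j) t) c atTop ∧
      (PointNormal.maxEdge P < ⊤ →
        TendstoUniformly
          (fun (j : ℕ) (t : ℝ) => PointNormal.pointCurve j (PointNormal.m4pt P j) t) c atTop) ∧
      TendstoUniformly
        (fun (j : ℕ) (t : ℝ) => PointNormal.normalCurve j (PointNormal.m4pt P j) t) ν atTop) ∧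
    -- contractivity with every factor above 3/4 from some level on
    (∀ η : ℝ, 3 / 4 < η → ∃ J : ℕ, ∀ j : ℕ, J ≤ j →
      PointNormal.maxEdge (PointNormal.m4pt P (j + 1)) ≤
        ENNReal.ofReal η * PointNormal.maxEdge (PointNormal.m4pt P j)) := by
  obtain ⟨c, hc, hcP⟩ := PointNormal.exists_tendstoLocallyUniformly_pointCurve P
  obtain ⟨ν, hν, hνP⟩ := PointNormal.exists_tendstoUniformly_normalCurve P
  refine ⟨PointNormal.stepDefined_m4pt hP, ⟨c, ν, hc, hν, hcP, fun hfin => ?_, hνP⟩,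
    fun η hη => PointNormal.maxEdge_m4pt_succ_le_of_lt P (by linarith)⟩
  obtain ⟨c', -, hc'⟩ := PointNormal.exists_tendstoUniformly_pointCurve hfin.ne
  have h : c = c' := funext fun t => tendsto_nhds_unique
    (hcP.tendstoLocallyUniformlyOn.tendsto_at (Set.mem_univ t)) (hc'.tendsto_at t)
  rwa [h]
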